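/- Setting. Let $E=(E^0,E^1,r,s)$ be a directed graph (vertex and edge sets of arbitrary cardinality) in which every vertex emits and receives an edge, and let $\mathcal L:E^1\to\mathcal A$ be a labelling of its edges by a countable alphabet. For $n\ge 1$ let $\mathcal L(E^n)$ be the set of words $\mathcal L(e_1)\cdots\mathcal L(e_n)$, where $e_1\cdots e_n$ is a path of length $n$ (so $r(e_i)=s(e_{i+1})$), and put $\mathcal L^*(E)=\bigcup_{n\ge1}\mathcal L(E^n)$. For $\alpha\in\mathcal L^*(E)$ and $A\subseteq E^0$ let $r(\alpha)$ be the set of ranges of the paths labelled $\alpha$, and $r(A,\alpha)$ the set of ranges of the paths labelled $\alpha$ whose source is in $A$; if a letter $a$ labels no edge, then $r(a)=r(A,a)=\emptyset$. Let $L^1_A=\{\mathcal L(e): s(e)\in A\}$. Let $\mathcal E^{0,-}$ be the smallest collection of subsets of $E^0$ that contains $\emptyset$ and all $r(\alpha)$, $\alpha\in\mathcal L^*(E)$, and is closed under finite unions, finite intersections and relative ranges $A\mapsto r(A,\alpha)$, $\alpha\in\mathcal L^*(E)$. For $\ell\ge1$ let $\mathcal E^{0,-}_\ell$ be the smallest collection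 that contains $\emptyset$ and all $r(\alpha)$ with $\alpha\in\mathcal L^*(E)$, $|\alpha|\le\ell$, and is closed under finite unions and finite intersections. Assume that $(E,\mathcal L,\mathcal E^{0,-})$ is weakly left-resolving ($r(A,\alpha)\cap r(B,\alpha)=r(A\cap B,\alpha)$ for all $A,B\in\mathcal E^{0,-}$, $\alpha\in\mathcal L^*(E)$), set-finite ($L^1_A$ is finite for every $A\in\mathcal E^{0,-}$) and receiver set-finite (for all $A\in\mathcal E^{0,-}$ and $\ell\ge1$, only finitely many words in $\mathcal L(E^\ell)$ label a path with range in $A$). Let $C^*(E,\mathcal L,\mathcal E^{0,-})$ be the universal $C^*$-algebra generated by projections $p_A$ ($A\in\mathcal E^{0,-}$) and partial isometries $s_a$ ($a\in\mathcal A$) such that, for all $A,B\in\mathcal E^{0,-}$ and $a,b\in\mathcal A$: $p_\emptyset=0$, $p_Ap_B=p_{A\cap B}$, $p_{A\cup B}=p_A+p_B-p_{A\cap B}$; $p_As_a=s_ap_{r(A,a)}$; $s_a^*s_a=p_{r(a)}$, and $s_a^*s_b=0$ if $a\ne b$; $p_A=\sum_{a\in L^1_A}s_ap_{r(A,a)}s_a^*$.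 Let $\gamma$ be its gauge action: for $z\in\mathbb T$, $\gamma_z$ is the $*$-homomorphism with $\gamma_z(s_a)=zs_a$ and $\gamma_z(p_A)=p_A$. Write $s_\alpha=s_{a_1}\cdots s_{a_n}$ for $\alpha=a_1\cdots a_n$, and for $1\le k\le\ell$ put $$\mathcal F^k(\ell)=\overline{\operatorname{span}}\{s_\alpha p_As_\beta^*:\ \alpha,\beta\in\mathcal L(E^k),\ A\in\mathcal E^{0,-}_\ell\}.$$ Theorem (AF core). The closure $\mathcal F=\overline{\bigcup_{1\le k\le\ell}\mathcal F^k(\ell)}$ is a $C^*$-subalgebra of $C^*(E,\mathcal L,\mathcal E^{0,-})$ and an AF algebra, that is, it has an increasing sequence of finite-dimensional $*$-subalgebras whose union is dense in it. Moreover $\mathcal F$ is isomorphic to, and in fact equal to, the fixed-point algebra $C^*(E,\mathcal L,\mathcal E^{0,-})^\gamma=\{x:\gamma_z(x)=x\text{ for all }z\in\mathbb T\}$. -/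

import Mathlib

noncomputable section

open scoped ENNReal

universe u v w x

/-! ### Labelled graphs -/

/-- A directed graph with vertex set `V`, edge set `Ed`, source and range maps, together with a
labelling of the edges by letters of the alphabet `𝒜`. -/
structure LabelledGraph (V : Type u) (Ed : Type v) (𝒜 : Type w) where
  src : Ed → V
  rng : Ed → V
  lab : Ed → 𝒜

namespace LabelledGraph

variable {V : Type u} {Ed : Type v} {𝒜 : Type w} (E : LabelledGraph V Ed 𝒜)

/-- Every vertex emits an edge and receives an edge (no sinks, no sources). -/
def IsEssential : Prop :=
  ∀ v : V, (∃ e, E.src e = v) ∧ ∃ e, E.rng e = v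

/-- `E.HasPath u α v`: there is a path `e₁ ⋯ eₙ` in `E`, `n ≥ 1`, with source `u`, range `v` and
label `α = 𝓛(e₁) ⋯ 𝓛(eₙ)`. -/
inductive HasPath : V → List 𝒜 → V → Prop
  | edge (e : Ed) : HasPath (E.src e) [E.lab e] (E.rng e)
  | cons (e : Ed) {α : List 𝒜} {v : V} (h : HasPath (E.rng e) α v) :
      HasPath (E.src e) (E.lab e :: α) v

/-- `𝓛*(E)`, the set of labelled paths (of length at least one). -/
def labelledPaths : Set (List 𝒜) :=
  {α | ∃ u v, E.HasPath u α v}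

/-- `𝓛(Eⁿ)`, the set of labelled paths of length `n` (used for `n ≥ 1`). -/
def labelledPathsOfLength (n : ℕ) : Set (List 𝒜) :=
  {α | α ∈ E.labelledPaths ∧ α.length = n}

/-- The range `r(α)` of a labelled path `α`. -/
def range (α : List 𝒜) : Set V :=
  {v | ∃ u, E.HasPath u α v}

/-- The relative range `r(A, α)`. -/
def relRange (A : Set V) (α : List 𝒜) : Set V :=
  {v | ∃ u ∈ A, E.HasPath u α v}

/-- `L¹_A`, the set of labels of edges whose source is in `A`. -/
def emitted (A : Set V) : Set 𝒜 :=
  {a | ∃ e, E.src e ∈ A ∧ E.lab e = a}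

/-- A collection of sets which is closed under finite intersections and finite unions (the empty
set being the empty union). -/
structure IsSetLattice (𝓑 : Set (Set V)) : Prop where
  empty_mem : ∅ ∈ 𝓑
  inter_mem : ∀ A ∈ 𝓑, ∀ B ∈ 𝓑, A ∩ B ∈ 𝓑
  union_mem : ∀ A ∈ 𝓑, ∀ B ∈ 𝓑, A ∪ B ∈ 𝓑

/-- Accommodating collections of vertex sets. -/
structure IsAccommodating (𝓑 : Set (Set V)) : Prop extends IsSetLattice 𝓑 where
  relRange_mem : ∀ A ∈ 𝓑, ∀ α ∈ E.labelledPaths, E.relRange A α ∈ 𝓑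
  range_mem : ∀ α ∈ E.labelledPaths, E.range α ∈ 𝓑

/-- `𝓔^{0,-}`, the smallest accommodating collection. -/
def accSets : Set (Set V) :=
  ⋂₀ {𝓑 | E.IsAccommodating 𝓑}

/-- `𝓔^{0,-}_ℓ`, the smallest collection which contains `r(α)` for all labelled paths `α` of length
at most `ℓ` and is closed under finite intersections and finite unions. -/
def accSetsLevel (ℓ : ℕ) : Set (Set V) :=
  ⋂₀ {𝓑 | IsSetLattice 𝓑 ∧ ∀ α ∈ E.labelledPaths, α.length ≤ ℓ → E.range α ∈ 𝓑}

/-- The labelled space `(E, 𝓛, 𝓔^{0,-})` is weakly left-resolving. -/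
def IsWeaklyLeftResolving : Prop :=
  ∀ A ∈ E.accSets, ∀ B ∈ E.accSets, ∀ α ∈ E.labelledPaths,
    E.relRange A α ∩ E.relRange B α = E.relRange (A ∩ B) α

/-- The labelled space `(E, 𝓛, 𝓔^{0,-})` is set-finite. -/
def IsSetFinite : Prop :=
  ∀ A ∈ E.accSets, (E.emitted A).Finite

/-- The labelled space `(E, 𝓛, 𝓔^{0,-})` is receiver set-finite: for all `ℓ ≥ 1`, each of its sets
receives only finitely many labelled paths of length `ℓ`. -/
def IsReceiverSetFinite : Prop :=
  ∀ A ∈ E.accSets, ∀ ℓ : ℕ, 1 ≤ ℓ →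
    {α : List 𝒜 | α.length = ℓ ∧ ∃ u, ∃ v ∈ A, E.HasPath u α v}.Finite

theorem accSets_isAccommodating : E.IsAccommodating E.accSets where
  empty_mem := fun _ h => h.empty_mem
  inter_mem := fun A hA B hB 𝓑 h => h.inter_mem A (hA 𝓑 h) B (hB 𝓑 h)
  union_mem := fun A hA B hB 𝓑 h => h.union_mem A (hA 𝓑 h) B (hB 𝓑 h)
  relRange_mem := fun A hA α hα 𝓑 h => h.relRange_mem A (hA 𝓑 h) α hα
  range_mem := fun α hα _ h => h.range_mem α hα

theorem inter_mem_accSets {A B : Set V} (hA : A ∈ E.accSets) (hB : B ∈ E.accSets) :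
    A ∩ B ∈ E.accSets :=
  E.accSets_isAccommodating.inter_mem A hA B hB

theorem union_mem_accSets {A B : Set V} (hA : A ∈ E.accSets) (hB : B ∈ E.accSets) :
    A ∪ B ∈ E.accSets :=
  E.accSets_isAccommodating.union_mem A hA B hB

theorem range_mem_accSets (α : List 𝒜) : E.range α ∈ E.accSets := by
  by_cases h : α ∈ E.labelledPaths
  · exact E.accSets_isAccommodating.range_mem α h
  · have : E.range α = ∅ := by
      ext v
      simp only [Set.mem_empty_iff_false, iff_false]
      rintro ⟨u, hu⟩
      exact h ⟨u, v, hu⟩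
    rw [this]
    exact E.accSets_isAccommodating.empty_mem

theorem relRange_mem_accSets {A : Set V} (hA : A ∈ E.accSets) (α : List 𝒜) :
    E.relRange A α ∈ E.accSets := by
  by_cases h : α ∈ E.labelledPaths
  · exact E.accSets_isAccommodating.relRange_mem A hA α h
  · have : E.relRange A α = ∅ := by
      ext v
      simp only [Set.mem_empty_iff_false, iff_false]
      rintro ⟨u, -, hu⟩
      exact h ⟨u, v, hu⟩
    rw [this]
    exact E.accSets_isAccommodating.empty_mem

/-! ### Representations of a labelled space -/

/-- A representation of the labelled space `(E, 𝓛, 𝓔^{0,-})` in a C⋆-algebra `B`. The last relation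
is imposed for the sets `A` which emit finitely many labels; these are all the sets of `𝓔^{0,-}`
when the space is set-finite. -/
structure Representation (B : Type x) [NonUnitalCStarAlgebra B] where
  p : E.accSets → B
  s : 𝒜 → B
  p_proj : ∀ A, IsStarProjection (p A)
  s_partialIsometry : ∀ a, s a * star (s a) * s a = s a
  p_empty : p ⟨∅, E.accSets_isAccommodating.empty_mem⟩ = 0
  p_inter : ∀ A B : E.accSets, p A * p B = p ⟨A.1 ∩ B.1, E.inter_mem_accSets A.2 B.2⟩
  p_union : ∀ A B : E.accSets, p ⟨A.1 ∪ B.1, E.union_mem_accSets A.2 B.2⟩ =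
    p A + p B - p ⟨A.1 ∩ B.1, E.inter_mem_accSets A.2 B.2⟩
  p_mul_s : ∀ (A : E.accSets) (a : 𝒜),
    p A * s a = s a * p ⟨E.relRange A.1 [a], E.relRange_mem_accSets A.2 [a]⟩
  star_s_mul_s : ∀ a, star (s a) * s a = p ⟨E.range [a], E.range_mem_accSets [a]⟩
  star_s_mul_s_of_ne : ∀ a b, a ≠ b → star (s a) * s b = 0
  p_eq_sum : ∀ (A : E.accSets) (F : Finset 𝒜), (F : Set 𝒜) = E.emitted A.1 →
    p A = ∑ a ∈ F,
      s a * p ⟨E.relRange A.1 [a], E.relRange_mem_accSets A.2 [a]⟩ * star (s a)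

namespace Representation

variable {E} {B : Type x} [NonUnitalCStarAlgebra B] (ρ : E.Representation B)

theorem norm_p_le (A : E.accSets) : ‖ρ.p A‖ ≤ 1 :=
  IsStarProjection.norm_le _ (ρ.p_proj A)

theorem norm_s_le (a : 𝒜) : ‖ρ.s a‖ ≤ 1 := by
  have h1 : ‖ρ.s a‖ * ‖ρ.s a‖ ≤ 1 := by
    rw [← CStarRing.norm_star_mul_self, ρ.star_s_mul_s]
    exact ρ.norm_p_le _
  nlinarith [norm_nonneg (ρ.s a)]

/-- A family which an injective ⋆-homomorphism maps to a representation is a representation. -/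
def pullback {C : Type*} [NonUnitalCStarAlgebra C] (j : C →⋆ₙₐ[ℂ] B) (hj : Function.Injective j)
    (p : E.accSets → C) (s : 𝒜 → C) (hp : ∀ A, j (p A) = ρ.p A) (hs : ∀ a, j (s a) = ρ.s a) :
    E.Representation C where
  p := p
  s := s
  p_proj A := ⟨hj (by simpa [hp] using (ρ.p_proj A).isIdempotentElem.eq),
    hj (by simpa [hp, map_star] using (ρ.p_proj A).isSelfAdjoint.star_eq)⟩
  s_partialIsometry a := hj (by simpa [hs, map_star] using ρ.s_partialIsometry a)
  p_empty := hj (by simpa [hp] using ρ.p_empty)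
  p_inter A B := hj (by simpa [hp] using ρ.p_inter A B)
  p_union A B := hj (by simpa [hp] using ρ.p_union A B)
  p_mul_s A a := hj (by simpa [hp, hs] using ρ.p_mul_s A a)
  star_s_mul_s a := hj (by simpa [hp, hs, map_star] using ρ.star_s_mul_s a)
  star_s_mul_s_of_ne a b h := hj (by simpa [hs, map_star] using ρ.star_s_mul_s_of_ne a b h)
  p_eq_sum A F hF := hj (by simpa [hp, hs, map_star] using ρ.p_eq_sum A F hF)

/-- For `z` of modulus one, `(z s_a, p_A)` is again a representation. -/
def twist (z : Circle) : E.Representation B :=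
  have hz : star (z : ℂ) * (z : ℂ) = 1 := by
    simp [← Complex.normSq_eq_conj_mul_self]
  { p := ρ.p
    s := fun a => (z : ℂ) • ρ.s a
    p_proj := ρ.p_proj
    s_partialIsometry := fun a => by
      generalize (z : ℂ) = c at hz
      have h := ρ.s_partialIsometry a
      simp only [star_smul, smul_mul_assoc, mul_smul_comm, h]
      rw [smul_smul (star c), hz, one_smul]
    p_empty := ρ.p_empty
    p_inter := ρ.p_inter
    p_union := ρ.p_union
    p_mul_s := fun A a => by rw [mul_smul_comm, ρ.p_mul_s, smul_mul_assoc]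
    star_s_mul_s := fun a => by
      generalize (z : ℂ) = c at hz
      simp only [star_smul, smul_mul_assoc, mul_smul_comm, smul_smul, mul_comm c, hz,
        one_smul, ρ.star_s_mul_s]
    star_s_mul_s_of_ne := fun a b h => by
      simp only [star_smul, smul_mul_assoc, mul_smul_comm, ρ.star_s_mul_s_of_ne a b h, smul_zero]
    p_eq_sum := fun A F hF => by
      generalize (z : ℂ) = c at hz
      rw [mul_comm] at hz
      rw [ρ.p_eq_sum A F hF]
      refine Finset.sum_congr rfl fun a _ => ?_
      simp only [star_smul, smul_mul_assoc, mul_smul_comm, smul_smul, mul_comm (star c), hz,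
        one_smul] }

end Representation

/-! ### The universal C⋆-algebra -/

/-- A C⋆-algebra in the universe of the generators together with a representation in it. -/
structure BundledRep where
  carrier : Type (max u w)
  [inst : NonUnitalCStarAlgebra carrier]
  rep : E.Representation carrier

attribute [instance] BundledRep.inst

/-- The C⋆-algebra of bounded families `(x_ρ)`, `x_ρ` in the target of the representation `ρ`. -/
abbrev BoundedFamilies : Type _ :=
  lp (fun i : E.BundledRep => i.carrier) ∞

/-- The family `(p_A^ρ)_ρ`. -/
def familyP (A : E.accSets) : E.BoundedFamilies :=
  ⟨fun i => i.rep.p A, memℓp_infty ⟨1, by rintro _ ⟨i, rfl⟩; exact i.rep.norm_p_le A⟩⟩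

/-- The family `(s_a^ρ)_ρ`. -/
def familyS (a : 𝒜) : E.BoundedFamilies :=
  ⟨fun i => i.rep.s a, memℓp_infty ⟨1, by rintro _ ⟨i, rfl⟩; exact i.rep.norm_s_le a⟩⟩

/-- The closed ⋆-subalgebra generated by the families `(p_A^ρ)_ρ` and `(s_a^ρ)_ρ`. -/
def universalSubalgebra : NonUnitalStarSubalgebra ℂ E.BoundedFamilies :=
  (NonUnitalStarAlgebra.adjoin ℂ
    (Set.range E.familyP ∪ Set.range E.familyS)).topologicalClosure

/-- The C⋆-algebra `C*(E, 𝓛, 𝓔^{0,-})`, that is, the universal C⋆-algebra generated by a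
representation; see `existsUnique_lift` for its universal property. -/
def CStar : Type _ := E.universalSubalgebra

instance : NonUnitalCStarAlgebra E.CStar :=
  NonUnitalStarSubalgebra.nonUnitalCStarAlgebra E.universalSubalgebra
    (h_closed := NonUnitalStarSubalgebra.isClosed_topologicalClosure _)


/-- The generators of `C*(E, 𝓛, 𝓔^{0,-})` form a representation. -/
def universalRep : E.Representation E.CStar :=
  Representation.pullback
    (B := E.BoundedFamilies) (C := E.CStar)
    { p := E.familyP
      s := E.familyS
      p_proj := fun A => ⟨lp.ext <| funext fun i => (i.rep.p_proj A).isIdempotentElem.eq,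
        lp.ext <| funext fun i => (i.rep.p_proj A).isSelfAdjoint.star_eq⟩
      s_partialIsometry := fun a => lp.ext <| funext fun i => i.rep.s_partialIsometry a
      p_empty := lp.ext <| funext fun i => i.rep.p_empty
      p_inter := fun A B => lp.ext <| funext fun i => i.rep.p_inter A B
      p_union := fun A B => lp.ext <| funext fun i => i.rep.p_union A B
      p_mul_s := fun A a => lp.ext <| funext fun i => i.rep.p_mul_s A a
      star_s_mul_s := fun a => lp.ext <| funext fun i => i.rep.star_s_mul_s a
      star_s_mul_s_of_ne := fun a b h => lp.ext <| funext fun i => i.rep.star_s_mul_s_of_ne a b h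
      p_eq_sum := fun A F hF => lp.ext <| funext fun i => by
        rw [lp.coeFn_sum, Finset.sum_apply]
        exact i.rep.p_eq_sum A F hF }
    (NonUnitalStarSubalgebraClass.subtype E.universalSubalgebra) Subtype.val_injective
    (fun A => ⟨E.familyP A, NonUnitalStarSubalgebra.le_topologicalClosure _
      (NonUnitalStarAlgebra.subset_adjoin ℂ _ (Or.inl ⟨A, rfl⟩))⟩)
    (fun a => ⟨E.familyS a, NonUnitalStarSubalgebra.le_topologicalClosure _
      (NonUnitalStarAlgebra.subset_adjoin ℂ _ (Or.inr ⟨a, rfl⟩))⟩)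
    (fun _ => rfl) (fun _ => rfl)

/-- Two ⋆-homomorphisms on `C*(E, 𝓛, 𝓔^{0,-})` which agree on the generators are equal. -/
theorem hom_ext {B : Type x} [NonUnitalCStarAlgebra B] {φ ψ : E.CStar →⋆ₙₐ[ℂ] B}
    (hp : ∀ A, φ (E.universalRep.p A) = ψ (E.universalRep.p A))
    (hs : ∀ a, φ (E.universalRep.s a) = ψ (E.universalRep.s a)) : φ = ψ := by
  have hφ : Continuous φ :=
    AddMonoidHomClass.continuous_of_bound φ 1 fun x => by
      simpa using NonUnitalStarAlgHom.norm_apply_le φ x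
  have hψ : Continuous ψ :=
    AddMonoidHomClass.continuous_of_bound ψ 1 fun x => by
      simpa using NonUnitalStarAlgHom.norm_apply_le ψ x
  have key : ∀ (x : E.BoundedFamilies)
      (hx : x ∈ NonUnitalStarAlgebra.adjoin ℂ (Set.range E.familyP ∪ Set.range E.familyS)),
      φ (⟨x, NonUnitalStarSubalgebra.le_topologicalClosure _ hx⟩ : E.universalSubalgebra) =
      ψ (⟨x, NonUnitalStarSubalgebra.le_topologicalClosure _ hx⟩ : E.universalSubalgebra) := by
    intro x hx
    induction hx using NonUnitalStarAlgebra.adjoin_induction with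
    | mem x hx =>
      rcases hx with ⟨A, rfl⟩ | ⟨a, rfl⟩
      · exact hp A
      · exact hs a
    | add x y hx hy h1 h2 =>
      exact (map_add φ _ _).trans ((congrArg₂ (· + ·) h1 h2).trans (map_add ψ _ _).symm)
    | zero => exact (map_zero φ).trans (map_zero ψ).symm
    | mul x y hx hy h1 h2 =>
      exact (map_mul φ _ _).trans ((congrArg₂ (· * ·) h1 h2).trans (map_mul ψ _ _).symm)
    | smul r x hx h1 =>
      exact (map_smul φ r _).trans ((congrArg (r • ·) h1).trans (map_smul ψ r _).symm)
    | star x hx h1 =>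
      exact (map_star φ _).trans ((congrArg star h1).trans (map_star ψ _).symm)
  ext ⟨x, hx⟩
  obtain ⟨f, hf, hfx⟩ := mem_closure_iff_seq_limit.1 hx
  have hlim : Filter.Tendsto (fun n => (⟨f n, NonUnitalStarSubalgebra.le_topologicalClosure _
      (hf n)⟩ : E.universalSubalgebra)) Filter.atTop (nhds ⟨x, hx⟩) :=
    tendsto_subtype_rng.2 hfx
  refine tendsto_nhds_unique ((hφ.tendsto _).comp hlim) ?_
  refine ((hψ.tendsto _).comp hlim).congr fun n => ?_
  exact (key (f n) (hf n)).symm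

/-- Formal ⋆-polynomials in a set of generators. -/
inductive StarTerm (G : Type u) : Type u
  | gen (g : G)
  | zero
  | add (s t : StarTerm G)
  | mul (s t : StarTerm G)
  | smul (c : ℂ) (t : StarTerm G)
  | star (t : StarTerm G)

/-- Evaluation of formal ⋆-polynomials. -/
def StarTerm.eval {G : Type u} {B : Type x} [NonUnitalCStarAlgebra B] (f : G → B) :
    StarTerm G → B
  | gen g => f g
  | zero => 0
  | add s t => s.eval f + t.eval f
  | mul s t => s.eval f * t.eval f
  | smul c t => c • t.eval f
  | star t => Star.star (t.eval f)

theorem small_topologicalClosure_adjoin {G : Type u} {B : Type x} [NonUnitalCStarAlgebra B]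
    (f : G → B) :
    Small.{u} (NonUnitalStarAlgebra.adjoin ℂ (Set.range f)).topologicalClosure := by
  have h1 : (NonUnitalStarAlgebra.adjoin ℂ (Set.range f) : Set B) ⊆
      Set.range (StarTerm.eval f) := by
    intro x hx
    induction hx using NonUnitalStarAlgebra.adjoin_induction with
    | mem x hx => obtain ⟨g, rfl⟩ := hx; exact ⟨.gen g, rfl⟩
    | add x y hx hy h1 h2 =>
      obtain ⟨s, rfl⟩ := h1; obtain ⟨t, rfl⟩ := h2; exact ⟨.add s t, rfl⟩
    | zero => exact ⟨.zero, rfl⟩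
    | mul x y hx hy h1 h2 =>
      obtain ⟨s, rfl⟩ := h1; obtain ⟨t, rfl⟩ := h2; exact ⟨.mul s t, rfl⟩
    | smul r x hx h1 => obtain ⟨s, rfl⟩ := h1; exact ⟨.smul r s, rfl⟩
    | star x hx h1 => obtain ⟨s, rfl⟩ := h1; exact ⟨.star s, rfl⟩
  have h2 : ((NonUnitalStarAlgebra.adjoin ℂ (Set.range f)).topologicalClosure : Set B) ⊆
      Set.range (fun g : ℕ → StarTerm G => Classical.epsilon (h := ⟨(0 : B)⟩) fun x =>
        Filter.Tendsto (fun n => (g n).eval f) Filter.atTop (nhds x)) := by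
    intro x hx
    obtain ⟨y, hy, hyx⟩ := mem_closure_iff_seq_limit.1 hx
    choose g hg using fun n => h1 (hy n)
    have hgx : Filter.Tendsto (fun n => (g n).eval f) Filter.atTop (nhds x) :=
      hyx.congr fun n => (hg n).symm
    exact ⟨g, tendsto_nhds_unique (Classical.epsilon_spec (p := fun x : B =>
      Filter.Tendsto (fun n => (g n).eval f) Filter.atTop (nhds x)) ⟨x, hgx⟩) hgx⟩
  exact small_subset h2

/-- Transport of a C⋆-algebra structure along a bijection. -/
theorem exists_cstarAlgebra_of_equiv {B : Type x} [NonUnitalCStarAlgebra B] {K : Type u}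
    (e : K ≃ B) : ∃ (_ : NonUnitalCStarAlgebra K) (j : K →⋆ₙₐ[ℂ] B), ⇑j = e := by
  let i1 : NonUnitalRing K := e.nonUnitalRing
  let i2 : Module ℂ K := e.module ℂ
  let i3 : StarRing K := e.starRing
  let j0 : K →ₙ+* B :=
    { toFun := e
      map_mul' := fun x y => by simp [Equiv.mul_def]
      map_zero' := by simp [Equiv.zero_def]
      map_add' := fun x y => by simp [Equiv.add_def] }
  let i4 : NonUnitalNormedRing K := NonUnitalNormedRing.induced K B j0 e.injective
  have hn : ∀ x : K, ‖x‖ = ‖e x‖ := fun _ => rfl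
  have hsm : ∀ (c : ℂ) (x : K), e (c • x) = c • e x := fun c x => by simp [Equiv.smul_def]
  have hmul : ∀ x y : K, e (x * y) = e x * e y := fun x y => j0.map_mul x y
  have hst : ∀ x : K, e (star x) = star (e x) := fun x => e.apply_symm_apply _
  have hiso : Isometry e := AddMonoidHomClass.isometry_of_norm j0 fun x => rfl
  let i5 : NormedSpace ℂ K := 
    { i2 with
      norm_smul_le := fun c x => by rw [hn, hn, hsm]; exact norm_smul_le c (e x) }
  let i6 : NonUnitalCStarAlgebra K :=
    { i4, i3, i5 with
      complete := ((IsometryEquiv.mk e hiso).completeSpace).complete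
      norm_mul_self_le := fun x => by
        rw [hn, hn, hmul, hst]; exact CStarRing.norm_mul_self_le (e x)
      smul_assoc := fun c x y => e.injective (by
        simp only [smul_eq_mul, hsm, hmul, smul_mul_assoc])
      smul_comm := fun c x y => e.injective (by
        simp only [smul_eq_mul, hsm, hmul, mul_smul_comm])
      star_smul := fun c x => e.injective (by simp only [hsm, hst, star_smul]) }
  exact ⟨i6, { j0 with map_smul' := hsm, map_star' := hst }, rfl⟩

/-- The universal property of `C*(E, 𝓛, 𝓔^{0,-})`: every representation in a C⋆-algebra (in an
arbitrary universe) is the image of the universal one under exactly one ⋆-homomorphism. -/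
theorem existsUnique_lift {B : Type x} [NonUnitalCStarAlgebra B] (ρ : E.Representation B) :
    ∃! φ : E.CStar →⋆ₙₐ[ℂ] B, (∀ A, φ (E.universalRep.p A) = ρ.p A) ∧
      ∀ a, φ (E.universalRep.s a) = ρ.s a := by
  suffices h : ∃ φ : E.CStar →⋆ₙₐ[ℂ] B, (∀ A, φ (E.universalRep.p A) = ρ.p A) ∧
      ∀ a, φ (E.universalRep.s a) = ρ.s a by
    obtain ⟨φ, h1, h2⟩ := h
    exact ⟨φ, ⟨h1, h2⟩, fun ψ hψ => E.hom_ext (fun A => (hψ.1 A).trans (h1 A).symm)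
      fun a => (hψ.2 a).trans (h2 a).symm⟩
  let f : E.accSets ⊕ 𝒜 → B := Sum.elim ρ.p ρ.s
  let C := (NonUnitalStarAlgebra.adjoin ℂ (Set.range f)).topologicalClosure
  have hC : ∀ g, f g ∈ C := fun g => NonUnitalStarSubalgebra.le_topologicalClosure _
    (NonUnitalStarAlgebra.subset_adjoin ℂ _ ⟨g, rfl⟩)
  have : IsClosed (C : Set B) := NonUnitalStarSubalgebra.isClosed_topologicalClosure _
  have : Small.{max u w} C := small_topologicalClosure_adjoin f
  obtain ⟨K, ⟨e⟩⟩ := Small.equiv_small.{max u w} (α := C)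
  obtain ⟨hK, j, hj⟩ := exists_cstarAlgebra_of_equiv e.symm
  let ι : C →⋆ₙₐ[ℂ] B := NonUnitalStarSubalgebraClass.subtype C
  have hι : Function.Injective (ι.comp j) := by
    rw [NonUnitalStarAlgHom.coe_comp]
    exact Subtype.val_injective.comp (by rw [hj]; exact e.symm.injective)
  have hgen : ∀ g, ι.comp j (e ⟨f g, hC g⟩) = f g := fun g => by
    rw [NonUnitalStarAlgHom.comp_apply, hj, Equiv.symm_apply_apply]
    rfl
  let σ : E.Representation K := ρ.pullback (ι.comp j) hι
    (fun A => e ⟨f (.inl A), hC _⟩) (fun a => e ⟨f (.inr a), hC _⟩)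
    (fun A => hgen _) (fun a => hgen _)
  let i : E.BundledRep := ⟨K, σ⟩
  let ev : E.CStar →⋆ₙₐ[ℂ] i.carrier :=
    { toFun := fun x => x.1 i
      map_smul' := fun _ _ => rfl
      map_zero' := rfl
      map_add' := fun _ _ => rfl
      map_mul' := fun _ _ => rfl
      map_star' := fun _ => rfl }
  exact ⟨(ι.comp j).comp ev, fun A => hgen (.inl A), fun a => hgen (.inr a)⟩

/-- The ⋆-homomorphism on `C*(E, 𝓛, 𝓔^{0,-})` given by a representation. -/
def lift {B : Type x} [NonUnitalCStarAlgebra B] (ρ : E.Representation B) : E.CStar →⋆ₙₐ[ℂ] B :=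
  (E.existsUnique_lift ρ).choose

theorem lift_p {B : Type x} [NonUnitalCStarAlgebra B] (ρ : E.Representation B) (A : E.accSets) :
    E.lift ρ (E.universalRep.p A) = ρ.p A :=
  (E.existsUnique_lift ρ).choose_spec.1.1 A

theorem lift_s {B : Type x} [NonUnitalCStarAlgebra B] (ρ : E.Representation B) (a : 𝒜) :
    E.lift ρ (E.universalRep.s a) = ρ.s a :=
  (E.existsUnique_lift ρ).choose_spec.1.2 a

/-! ### Gauge action and core -/

/-- The gauge action: `γ_z` is the ⋆-homomorphism with `γ_z(p_A) = p_A` and `γ_z(s_a) = z s_a`. -/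
def gauge (z : Circle) : E.CStar →⋆ₙₐ[ℂ] E.CStar :=
  E.lift (E.universalRep.twist z)

theorem gauge_p (z : Circle) (A : E.accSets) :
    E.gauge z (E.universalRep.p A) = E.universalRep.p A :=
  E.lift_p _ A

theorem gauge_s (z : Circle) (a : 𝒜) :
    E.gauge z (E.universalRep.s a) = (z : ℂ) • E.universalRep.s a :=
  E.lift_s _ a

/-- The fixed-point algebra `C*(E, 𝓛, 𝓔^{0,-})^γ`. -/
def gaugeFixedPoints : NonUnitalStarSubalgebra ℂ E.CStar where
  carrier := {x | ∀ z, E.gauge z x = x}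
  add_mem' := fun hx hy z => by rw [map_add, hx z, hy z]
  zero_mem' := fun z => map_zero _
  mul_mem' := fun hx hy z => by rw [map_mul, hx z, hy z]
  smul_mem' := fun c x hx z => by rw [map_smul, hx z]
  star_mem' := fun hx z => by rw [map_star, hx z]

/-- `s_α = s_{a₁} ⋯ s_{aₙ}` for a word `α = a₁ ⋯ aₙ` with `n ≥ 1`. The value at the empty word is
not used. -/
def sWord : List 𝒜 → E.CStar
  | [] => 0
  | [a] => E.universalRep.s a
  | a :: b :: α => E.universalRep.s a * sWord (b :: α)

/-- `𝓕^k(ℓ)`, the closed linear span of the elements `s_α p_A s_β^*` with `α, β ∈ 𝓛(E^k)` and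
`A ∈ 𝓔^{0,-}_ℓ`. -/
def coreLevel (k ℓ : ℕ) : Submodule ℂ E.CStar :=
  (Submodule.span ℂ {x | ∃ α ∈ E.labelledPathsOfLength k, ∃ β ∈ E.labelledPathsOfLength k,
    ∃ A : E.accSets, A.1 ∈ E.accSetsLevel ℓ ∧
      x = E.sWord α * E.universalRep.p A * star (E.sWord β)}).topologicalClosure

/-- The closure of the union of all `𝓕^k(ℓ)` with `1 ≤ k ≤ ℓ`. -/
def coreSet : Set E.CStar :=
  closure (⋃ (k : ℕ) (ℓ : ℕ) (_ : 1 ≤ k) (_ : k ≤ ℓ), (E.coreLevel k ℓ : Set E.CStar))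

end LabelledGraph

/-- A C⋆-subalgebra `B` of a C⋆-algebra is an AF algebra: it is closed, and there is an increasing
sequence of finite-dimensional ⋆-subalgebras of `B` whose union is dense in `B`. -/
def IsAFSubalgebra {C : Type x} [NonUnitalCStarAlgebra C] (B : NonUnitalStarSubalgebra ℂ C) :
    Prop :=
  IsClosed (B : Set C) ∧ ∃ F : ℕ → NonUnitalStarSubalgebra ℂ B, Monotone F ∧
    (∀ n, FiniteDimensional ℂ (F n)) ∧ Dense (⋃ n, (F n : Set B))

end

/-!
The proof works with the monomials `s_α p_A s_β^*`, where the words `α`, `β` may be empty. Their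
linear span is stable under left multiplication by the generators and their adjoints, so it is a
dense ⋆-subalgebra (`dense_monomialSpan`), on which `γ_z` multiplies `s_α p_A s_β^*` by
`z ^ (|α| - |β|)`. Let `D` (`degreeZeroSpan`) be the span of the monomials with `|α| = |β|`. Both
the core and the fixed-point algebra are the closure of `D`.

* Fixed points (`gaugeFixedPoints_eq_closure`): instead of integrating the gauge action over the
  circle, one averages `γ_z` over the `N`-th roots of unity. This contraction fixes every fixed
  point of `γ` and maps a given combination of monomials into `D` as soon as `N` is large.
* Core (`coreSet_eq_closure`): the relation `p_A = ∑ s_a p_{r(A,a)} s_a^*`, a finite sum over the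
  letters emitted by `A`, lengthens both words of a monomial in `D` by one letter. Hence each
  element of `D` is a combination of monomials whose words have one common length `k ≥ 1`, and the
  finitely many sets involved lie in a common level, because the levels exhaust `𝓔^{0,-}` for a
  weakly left-resolving space (`exists_mem_accSetsLevel`).

For the AF property, finitely many elements of `D` are again written with words of a common length
`k ≥ 1`. As `s_β^* s_μ` is `p_{r(β)}` or `0` for words of equal length, the products of such
monomials only involve intersections of the given sets and the ranges of the given words, of which
there are finitely many. So finitely many elements of `D` lie in a finite-dimensional ⋆-subalgebra
(`exists_finiteDimensional_of_finite`). The alphabet being countable, so are `𝓔^{0,-}` and the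
set of monomials; the ⋆-subalgebras generated by the first `n` monomials of an enumeration form the
required sequence.
-/

noncomputable section

namespace LabelledGraph

variable {V : Type u} {Ed : Type v} {𝒜 : Type w} {E : LabelledGraph V Ed 𝒜}

/-! ### Labelled paths and the sets they generate -/

theorem HasPath.ne_nil {u v : V} {α : List 𝒜} (h : E.HasPath u α v) : α ≠ [] := by
  cases h <;> simp

theorem hasPath_cons_iff {u v : V} {a : 𝒜} {α : List 𝒜} (hα : α ≠ []) :
    E.HasPath u (a :: α) v ↔ ∃ w, E.HasPath u [a] w ∧ E.HasPath w α v := by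
  constructor
  · intro h
    cases h with
    | edge e => exact absurd rfl hα
    | cons e h => exact ⟨_, .edge e, h⟩
  · rintro ⟨w, h1, h2⟩
    cases h1 with
    | edge e => exact .cons e h2
    | cons e h => exact absurd rfl h.ne_nil

theorem hasPath_append_iff {u v : V} {α β : List 𝒜} (hα : α ≠ []) (hβ : β ≠ []) :
    E.HasPath u (α ++ β) v ↔ ∃ w, E.HasPath u α w ∧ E.HasPath w β v := by
  induction α generalizing u with
  | nil => exact absurd rfl hα
  | cons a α ih =>
    rcases eq_or_ne α [] with rfl | h
    · exact hasPath_cons_iff hβ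
    · rw [List.cons_append, hasPath_cons_iff (by simp [h])]
      constructor
      · rintro ⟨x, h1, h2⟩
        obtain ⟨w, h3, h4⟩ := (ih h).1 h2
        exact ⟨w, (hasPath_cons_iff h).2 ⟨x, h1, h3⟩, h4⟩
      · rintro ⟨w, h1, h2⟩
        obtain ⟨x, h3, h4⟩ := (hasPath_cons_iff h).1 h1
        exact ⟨x, h3, (ih h).2 ⟨w, h4, h2⟩⟩

theorem relRange_relRange (A : Set V) {α β : List 𝒜} (hα : α ≠ []) (hβ : β ≠ []) :
    E.relRange (E.relRange A α) β = E.relRange A (α ++ β) := by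
  ext v
  constructor
  · rintro ⟨w, ⟨u, hu, h1⟩, h2⟩
    exact ⟨u, hu, (hasPath_append_iff hα hβ).2 ⟨w, h1, h2⟩⟩
  · rintro ⟨u, hu, h⟩
    obtain ⟨w, h1, h2⟩ := (hasPath_append_iff hα hβ).1 h
    exact ⟨w, ⟨u, hu, h1⟩, h2⟩

theorem relRange_range {α β : List 𝒜} (hα : α ≠ []) (hβ : β ≠ []) :
    E.relRange (E.range α) β = E.range (α ++ β) := by
  ext v
  constructor
  · rintro ⟨w, ⟨u, h1⟩, h2⟩
    exact ⟨u, (hasPath_append_iff hα hβ).2 ⟨w, h1, h2⟩⟩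
  · rintro ⟨u, h⟩
    obtain ⟨w, h1, h2⟩ := (hasPath_append_iff hα hβ).1 h
    exact ⟨w, ⟨u, h1⟩, h2⟩

theorem relRange_subset_range (A : Set V) (α : List 𝒜) : E.relRange A α ⊆ E.range α :=
  fun _ ⟨u, _, h⟩ => ⟨u, h⟩

theorem relRange_union (A B : Set V) (α : List 𝒜) :
    E.relRange (A ∪ B) α = E.relRange A α ∪ E.relRange B α := by
  ext v
  simp only [relRange, Set.mem_union, Set.mem_ofPred_eq, or_and_right, exists_or]

theorem relRange_empty (α : List 𝒜) : E.relRange ∅ α = ∅ := by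
  ext v
  simp [relRange]

theorem range_eq_empty {α : List 𝒜} (h : α ∉ E.labelledPaths) : E.range α = ∅ :=
  Set.eq_empty_iff_forall_notMem.2 fun v ⟨u, hu⟩ => h ⟨u, v, hu⟩

theorem accSetsLevel_isSetLattice (ℓ : ℕ) : IsSetLattice (E.accSetsLevel ℓ) where
  empty_mem := fun _ h => h.1.empty_mem
  inter_mem := fun A hA B hB 𝓑 h => h.1.inter_mem A (hA 𝓑 h) B (hB 𝓑 h)
  union_mem := fun A hA B hB 𝓑 h => h.1.union_mem A (hA 𝓑 h) B (hB 𝓑 h)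

theorem range_mem_accSetsLevel {α : List 𝒜} {ℓ : ℕ} (h : α.length ≤ ℓ) :
    E.range α ∈ E.accSetsLevel ℓ := by
  by_cases hα : α ∈ E.labelledPaths
  · exact fun 𝓑 h𝓑 => h𝓑.2 α hα h
  · rw [range_eq_empty hα]
    exact (accSetsLevel_isSetLattice ℓ).empty_mem

theorem accSetsLevel_mono : Monotone E.accSetsLevel := fun _ _ h _ hA 𝓑 h𝓑 =>
  hA 𝓑 ⟨h𝓑.1, fun α hα hl => h𝓑.2 α hα (hl.trans h)⟩

theorem relRange_mem_accSetsLevel (hwlr : E.IsWeaklyLeftResolving) {A : Set V} {ℓ : ℕ}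
    (hA : A ∈ E.accSetsLevel ℓ) {α : List 𝒜} (hα : α ∈ E.labelledPaths) :
    E.relRange A α ∈ E.accSetsLevel (ℓ + α.length) := by
  have hL := accSetsLevel_isSetLattice (E := E) (ℓ + α.length)
  refine (hA {A | A ∈ E.accSets ∧ E.relRange A α ∈ E.accSetsLevel (ℓ + α.length)}
    ⟨⟨⟨E.accSets_isAccommodating.empty_mem, ?_⟩, ?_, ?_⟩, ?_⟩).2
  · rw [relRange_empty]
    exact hL.empty_mem
  · rintro A ⟨hA, hA'⟩ B ⟨hB, hB'⟩
    refine ⟨E.inter_mem_accSets hA hB, ?_⟩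
    rw [← hwlr A hA B hB α hα]
    exact hL.inter_mem _ hA' _ hB'
  · rintro A ⟨hA, hA'⟩ B ⟨hB, hB'⟩
    refine ⟨E.union_mem_accSets hA hB, ?_⟩
    rw [relRange_union]
    exact hL.union_mem _ hA' _ hB'
  · rintro γ ⟨_, _, hγ⟩ hl
    obtain ⟨_, _, hα⟩ := hα
    refine ⟨E.range_mem_accSets γ, ?_⟩
    rw [relRange_range hγ.ne_nil hα.ne_nil]
    exact range_mem_accSetsLevel (by simpa using hl)

/-- The levels exhaust `𝓔^{0,-}`: their union absorbs relative ranges because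
`r(r(γ), α) = r(γα)` and, by weak left-resolvingness, `r(·, α)` commutes with intersections. -/
theorem exists_mem_accSetsLevel (hwlr : E.IsWeaklyLeftResolving) {A : Set V}
    (hA : A ∈ E.accSets) : ∃ ℓ, A ∈ E.accSetsLevel ℓ := by
  refine hA {A | ∃ ℓ, A ∈ E.accSetsLevel ℓ}
    ⟨⟨⟨0, (accSetsLevel_isSetLattice 0).empty_mem⟩, ?_, ?_⟩, ?_, ?_⟩
  · rintro A ⟨k, hA⟩ B ⟨l, hB⟩
    exact ⟨max k l, (accSetsLevel_isSetLattice _).inter_mem _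
      (accSetsLevel_mono (le_max_left k l) hA) _ (accSetsLevel_mono (le_max_right k l) hB)⟩
  · rintro A ⟨k, hA⟩ B ⟨l, hB⟩
    exact ⟨max k l, (accSetsLevel_isSetLattice _).union_mem _
      (accSetsLevel_mono (le_max_left k l) hA) _ (accSetsLevel_mono (le_max_right k l) hB)⟩
  · rintro A ⟨k, hA⟩ α hα
    exact ⟨_, relRange_mem_accSetsLevel hwlr hA hα⟩
  · exact fun α _ => ⟨α.length, range_mem_accSetsLevel le_rfl⟩

theorem countable_accSets [Countable 𝒜] : E.accSets.Countable := by
  -- Iterate one round of all the operations, starting from the countably many ranges.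
  let step (C : Set (Set V)) : Set (Set V) :=
    C ∪ Set.image2 (· ∩ ·) C C ∪ Set.image2 (· ∪ ·) C C ∪ Set.image2 E.relRange C Set.univ
  let C (n : ℕ) : Set (Set V) := step^[n] (insert ∅ (Set.range E.range))
  have hC (n : ℕ) : C (n + 1) = step (C n) := Function.iterate_succ_apply' _ _ _
  have hcount (n : ℕ) : (C n).Countable := by
    induction n with
    | zero => exact (Set.countable_range _).insert _
    | succ n ih =>
      rw [hC]
      exact ((ih.union (ih.image2 ih _)).union (ih.image2 ih _)).union
        (ih.image2 Set.countable_univ _)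
  have hmono : Monotone C := monotone_nat_of_le_succ fun n => by
    rw [hC]
    exact fun A hA => Or.inl (Or.inl (Or.inl hA))
  refine (Set.countable_iUnion hcount).mono fun A hA => hA _ ⟨⟨?_, ?_, ?_⟩, ?_, ?_⟩
  · exact Set.mem_iUnion.2 ⟨0, Set.mem_insert _ _⟩
  · intro A hA B hB
    obtain ⟨m, hA⟩ := Set.mem_iUnion.1 hA
    obtain ⟨n, hB⟩ := Set.mem_iUnion.1 hB
    refine Set.mem_iUnion.2 ⟨max m n + 1, ?_⟩
    rw [hC]
    exact Or.inl (Or.inl (Or.inr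
      ⟨A, hmono (le_max_left m n) hA, B, hmono (le_max_right m n) hB, rfl⟩))
  · intro A hA B hB
    obtain ⟨m, hA⟩ := Set.mem_iUnion.1 hA
    obtain ⟨n, hB⟩ := Set.mem_iUnion.1 hB
    refine Set.mem_iUnion.2 ⟨max m n + 1, ?_⟩
    rw [hC]
    exact Or.inl (Or.inr
      ⟨A, hmono (le_max_left m n) hA, B, hmono (le_max_right m n) hB, rfl⟩)
  · intro A hA α _
    obtain ⟨m, hA⟩ := Set.mem_iUnion.1 hA
    refine Set.mem_iUnion.2 ⟨m + 1, ?_⟩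
    rw [hC]
    exact Or.inr ⟨A, hA, α, trivial, rfl⟩
  · exact fun α _ => Set.mem_iUnion.2 ⟨0, Set.mem_insert_of_mem _ ⟨α, rfl⟩⟩

/-! ### Monomials -/

/-- `s_α x` for a word `α`, with the convention `s_α x = x` for the empty word. Since
`C*(E, 𝓛, 𝓔^{0,-})` need not have a unit, the empty word only acts by multiplication. -/
def wordMul : List 𝒜 → E.CStar → E.CStar
  | [], x => x
  | a :: α, x => E.universalRep.s a * wordMul α x

theorem wordMul_append (α β : List 𝒜) (x : E.CStar) :
    wordMul (α ++ β) x = wordMul α (wordMul β x) := by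
  induction α with
  | nil => rfl
  | cons a α ih => simp only [List.cons_append, wordMul, ih]

theorem wordMul_mul (α : List 𝒜) (x y : E.CStar) : wordMul α (x * y) = wordMul α x * y := by
  induction α with
  | nil => rfl
  | cons a α ih => simp only [wordMul, ih, mul_assoc]

theorem wordMul_eq_sWord_mul {α : List 𝒜} (hα : α ≠ []) (x : E.CStar) :
    wordMul α x = E.sWord α * x := by
  induction α with
  | nil => exact absurd rfl hα
  | cons a α ih =>
    cases α with
    | nil => rfl
    | cons b α => rw [wordMul, ih (by simp), sWord, mul_assoc]

theorem wordMul_star_wordMul (α β : List 𝒜) (x : E.CStar) :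
    wordMul α (star (wordMul β x)) = star (wordMul β (star (wordMul α (star x)))) := by
  induction α with
  | nil => simp only [wordMul, star_star]
  | cons a α ih => rw [wordMul, wordMul, ih, star_mul, wordMul_mul, star_mul, star_star]

theorem wordMul_sum {ι : Type*} (F : Finset ι) (α : List 𝒜) (f : ι → E.CStar) :
    wordMul α (∑ i ∈ F, f i) = ∑ i ∈ F, wordMul α (f i) := by
  induction α with
  | nil => rfl
  | cons a α ih => simp only [wordMul, ih, Finset.mul_sum]

/-- The element `s_α p_A s_β^*`, where `α` and `β` may be empty. -/
def monomial (α : List 𝒜) (A : E.accSets) (β : List 𝒜) : E.CStar :=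
  wordMul α (star (wordMul β (E.universalRep.p A)))

theorem star_p (A : E.accSets) : star (E.universalRep.p A) = E.universalRep.p A :=
  (E.universalRep.p_proj A).isSelfAdjoint.star_eq

theorem star_monomial (α : List 𝒜) (A : E.accSets) (β : List 𝒜) :
    star (monomial α A β) = monomial β A α := by
  rw [monomial, wordMul_star_wordMul, star_star, star_p, monomial]

theorem monomial_eq {α β : List 𝒜} (hα : α ≠ []) (hβ : β ≠ []) (A : E.accSets) :
    monomial α A β = E.sWord α * E.universalRep.p A * star (E.sWord β) := by
  rw [monomial, wordMul_eq_sWord_mul hα, wordMul_eq_sWord_mul hβ, star_mul, star_p, mul_assoc]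

theorem p_mul_sWord (A : E.accSets) (α : List 𝒜) :
    E.universalRep.p A * E.sWord α =
      E.sWord α * E.universalRep.p ⟨E.relRange A.1 α, E.relRange_mem_accSets A.2 α⟩ := by
  induction α generalizing A with
  | nil => simp [sWord]
  | cons a α ih =>
    cases α with
    | nil => exact E.universalRep.p_mul_s A a
    | cons b α =>
      rw [sWord, ← mul_assoc, E.universalRep.p_mul_s, mul_assoc, ih, mul_assoc]
      congr 3
      exact Subtype.ext (relRange_relRange _ (by simp) (by simp))

theorem star_sWord_mul_sWord {α : List 𝒜} (hα : α ≠ []) :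
    star (E.sWord α) * E.sWord α = E.universalRep.p ⟨E.range α, E.range_mem_accSets α⟩ := by
  induction α with
  | nil => exact absurd rfl hα
  | cons a α ih =>
    cases α with
    | nil => exact E.universalRep.star_s_mul_s a
    | cons b α =>
      rw [sWord, star_mul, mul_assoc, ← mul_assoc (star (E.universalRep.s a)),
        E.universalRep.star_s_mul_s, p_mul_sWord, ← mul_assoc, ih (by simp),
        E.universalRep.p_inter]
      congr 1
      refine Subtype.ext ?_
      change E.range (b :: α) ∩ E.relRange (E.range [a]) (b :: α) = E.range (a :: b :: α)
      rw [Set.inter_eq_right.2 (relRange_subset_range _ _), relRange_range (by simp) (by simp)]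
      rfl

theorem sWord_eq_zero {α : List 𝒜} (h : α ∉ E.labelledPaths) : E.sWord α = 0 := by
  rcases eq_or_ne α [] with rfl | hα
  · rfl
  rw [← CStarRing.star_mul_self_eq_zero_iff, star_sWord_mul_sWord hα, ← E.universalRep.p_empty]
  congr 1
  exact Subtype.ext (range_eq_empty h)

theorem star_sWord_mul_sWord_of_ne {α β : List 𝒜} (hl : α.length = β.length) (h : α ≠ β) :
    star (E.sWord α) * E.sWord β = 0 := by
  induction α generalizing β with
  | nil => simp [sWord]
  | cons a α ih =>
    cases β with
    | nil => simp [sWord]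
    | cons b β =>
      cases α with
      | nil =>
        obtain rfl : β = [] := by simpa using hl.symm
        exact E.universalRep.star_s_mul_s_of_ne a b (by simpa using h)
      | cons a' α =>
        cases β with
        | nil => simp at hl
        | cons b' β =>
          rw [sWord, sWord, star_mul, mul_assoc, ← mul_assoc (star (E.universalRep.s a))]
          by_cases hab : a = b
          · subst hab
            rw [E.universalRep.star_s_mul_s, p_mul_sWord, ← mul_assoc,
              ih (by simpa using hl) (by simpa using h), zero_mul]
          · rw [E.universalRep.star_s_mul_s_of_ne a b hab, zero_mul, mul_zero]

theorem monomial_mul_monomial_of_ne {α β μ ν : List 𝒜} (A B : E.accSets)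
    (hα : α ≠ []) (hβ : β ≠ []) (hμ : μ ≠ []) (hν : ν ≠ [])
    (hl : β.length = μ.length) (h : β ≠ μ) : monomial α A β * monomial μ B ν = 0 := by
  rw [monomial_eq hα hβ, monomial_eq hμ hν, mul_assoc, mul_assoc (E.sWord μ),
    ← mul_assoc (star (E.sWord β)), star_sWord_mul_sWord_of_ne hl h, zero_mul, mul_zero]

theorem monomial_mul_monomial {α β ν : List 𝒜} (A B : E.accSets)
    (hα : α ≠ []) (hβ : β ≠ []) (hν : ν ≠ []) :
    monomial α A β * monomial β B ν =
      monomial α ⟨A.1 ∩ (E.range β ∩ B.1), E.inter_mem_accSets A.2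
        (E.inter_mem_accSets (E.range_mem_accSets β) B.2)⟩ ν := by
  rw [monomial_eq hα hβ, monomial_eq hβ hν, monomial_eq hα hν, mul_assoc, mul_assoc (E.sWord β),
    ← mul_assoc (star (E.sWord β)), star_sWord_mul_sWord hβ,
    ← mul_assoc _ (E.universalRep.p B), E.universalRep.p_inter, ← mul_assoc, mul_assoc (E.sWord α),
    E.universalRep.p_inter]

/-- The relation `p_A = ∑ s_a p_{r(A,a)} s_a^*` rewrites a monomial through longer ones. -/
theorem monomial_eq_sum (hsf : E.IsSetFinite) (α : List 𝒜) (A : E.accSets) (β : List 𝒜) :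
    monomial α A β = ∑ a ∈ (hsf A.1 A.2).toFinset,
      monomial (α ++ [a]) ⟨E.relRange A.1 [a], E.relRange_mem_accSets A.2 [a]⟩ (β ++ [a]) := by
  rw [monomial, E.universalRep.p_eq_sum A (hsf A.1 A.2).toFinset (by simp), wordMul_sum, star_sum,
    wordMul_sum]
  refine Finset.sum_congr rfl fun a _ => ?_
  rw [monomial, wordMul_append, wordMul_append]
  congr 1
  simp only [wordMul]
  rw [wordMul_mul, star_mul, star_star, wordMul_mul, star_mul]

/-! ### Density of the monomials -/

/-- Left multiplication by `p_B` only changes the set of a monomial: it becomes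
`A ∩ r(B, α)`, or `A ∩ B` when `α` is empty. -/
theorem p_mul_monomial (B : E.accSets) (α : List 𝒜) (A : E.accSets) (β : List 𝒜) :
    ∃ C, E.universalRep.p B * monomial α A β = monomial α C β := by
  induction α generalizing B with
  | nil =>
    refine ⟨⟨A.1 ∩ B.1, E.inter_mem_accSets A.2 B.2⟩, ?_⟩
    simp only [monomial, wordMul]
    rw [← star_p B, ← star_mul, ← wordMul_mul, E.universalRep.p_inter]
  | cons a α ih =>
    obtain ⟨C, hC⟩ := ih ⟨E.relRange B.1 [a], E.relRange_mem_accSets B.2 [a]⟩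
    refine ⟨C, ?_⟩
    change _ * (_ * monomial α A β) = _ * monomial α C β
    rw [← mul_assoc, E.universalRep.p_mul_s, mul_assoc, hC]

/-- The linear span of all monomials. It is a dense ⋆-subalgebra: the lemmas below show that it is
stable under left multiplication by `p_B`, `s_a` and `s_a^*`, hence under products. -/
def monomialSpan (E : LabelledGraph V Ed 𝒜) : Submodule ℂ E.CStar :=
  Submodule.span ℂ {x | ∃ α A β, x = monomial α A β}

theorem monomial_mem_monomialSpan (α : List 𝒜) (A : E.accSets) (β : List 𝒜) :
    monomial α A β ∈ E.monomialSpan :=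
  Submodule.subset_span ⟨α, A, β, rfl⟩

theorem mul_mem_monomialSpan_of_monomial {b : E.CStar}
    (hb : ∀ α A β, b * monomial α A β ∈ E.monomialSpan) {x : E.CStar}
    (hx : x ∈ E.monomialSpan) : b * x ∈ E.monomialSpan := by
  induction hx using Submodule.span_induction with
  | mem x hx =>
    obtain ⟨α, A, β, rfl⟩ := hx
    exact hb α A β
  | zero => simp
  | add x y _ _ hx hy => simpa [mul_add] using add_mem hx hy
  | smul c x _ hx => simpa [mul_smul_comm] using Submodule.smul_mem _ c hx

theorem p_mul_mem (B : E.accSets) {x : E.CStar} (hx : x ∈ E.monomialSpan) :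
    E.universalRep.p B * x ∈ E.monomialSpan :=
  mul_mem_monomialSpan_of_monomial (fun α A β => by
    obtain ⟨C, hC⟩ := p_mul_monomial B α A β
    exact hC ▸ monomial_mem_monomialSpan α C β) hx

theorem s_mul_mem (a : 𝒜) {x : E.CStar} (hx : x ∈ E.monomialSpan) :
    E.universalRep.s a * x ∈ E.monomialSpan :=
  mul_mem_monomialSpan_of_monomial (fun α A β => monomial_mem_monomialSpan (a :: α) A β) hx

theorem star_s_mul_mem (a : 𝒜) {x : E.CStar} (hx : x ∈ E.monomialSpan) :
    star (E.universalRep.s a) * x ∈ E.monomialSpan := by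
  refine mul_mem_monomialSpan_of_monomial (fun α A β => ?_) hx
  cases α with
  | nil =>
    -- `s_a^* p_A s_β^* = p_{r(A,a)} s_{βa}^*`
    have : star (E.universalRep.s a) * monomial [] A β =
        monomial [] ⟨E.relRange A.1 [a], E.relRange_mem_accSets A.2 [a]⟩ (β ++ [a]) := by
      simp only [monomial, wordMul, wordMul_append]
      rw [← star_mul, ← wordMul_mul, E.universalRep.p_mul_s]
    exact this ▸ monomial_mem_monomialSpan _ _ _
  | cons b α =>
    change _ * (_ * monomial α A β) ∈ _
    rw [← mul_assoc]
    by_cases hab : a = b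
    · subst hab
      rw [E.universalRep.star_s_mul_s]
      exact p_mul_mem _ (monomial_mem_monomialSpan α A β)
    · rw [E.universalRep.star_s_mul_s_of_ne a b hab, zero_mul]
      exact zero_mem _

theorem star_mem_monomialSpan {x : E.CStar} (hx : x ∈ E.monomialSpan) :
    star x ∈ E.monomialSpan := by
  induction hx using Submodule.span_induction with
  | mem x hx =>
    obtain ⟨α, A, β, rfl⟩ := hx
    exact star_monomial α A β ▸ monomial_mem_monomialSpan β A α
  | zero => simp
  | add x y _ _ hx hy => simpa using add_mem hx hy
  | smul c x _ hx => simpa using Submodule.smul_mem _ _ hx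

theorem mul_mem_monomialSpan {x y : E.CStar} (hx : x ∈ E.monomialSpan)
    (hy : y ∈ E.monomialSpan) : x * y ∈ E.monomialSpan := by
  have hword (α : List 𝒜) {z : E.CStar} (hz : z ∈ E.monomialSpan) :
      wordMul α z ∈ E.monomialSpan := by
    induction α with
    | nil => exact hz
    | cons a α ih => exact s_mul_mem a ih
  have hstar (β : List 𝒜) (A : E.accSets) {z : E.CStar} (hz : z ∈ E.monomialSpan) :
      star (wordMul β (E.universalRep.p A)) * z ∈ E.monomialSpan := by
    induction β generalizing z with
    | nil =>
      rw [wordMul, star_p]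
      exact p_mul_mem A hz
    | cons b β ih =>
      rw [wordMul, star_mul, mul_assoc]
      exact ih (star_s_mul_mem b hz)
  induction hx using Submodule.span_induction with
  | mem x hx =>
    obtain ⟨α, A, β, rfl⟩ := hx
    rw [monomial, ← wordMul_mul]
    exact hword α (hstar β A hy)
  | zero => simp
  | add x z _ _ hx hz => simpa [add_mul] using add_mem hx hz
  | smul c x _ hx => simpa [smul_mul_assoc] using Submodule.smul_mem _ c hx

theorem dense_monomialSpan : Dense (E.monomialSpan : Set E.CStar) := by
  have key : ∀ x ∈ NonUnitalStarAlgebra.adjoin ℂ (Set.range E.familyP ∪ Set.range E.familyS),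
      ∃ y ∈ E.monomialSpan, (show E.universalSubalgebra from y).1 = x := by
    intro x hx
    induction hx using NonUnitalStarAlgebra.adjoin_induction with
    | mem x hx =>
      rcases hx with ⟨A, rfl⟩ | ⟨a, rfl⟩
      · refine ⟨E.universalRep.p A, ?_, rfl⟩
        simpa [monomial, wordMul, star_p] using monomial_mem_monomialSpan [] A []
      · refine ⟨E.universalRep.s a, ?_, rfl⟩
        rw [← E.universalRep.s_partialIsometry a, mul_assoc, E.universalRep.star_s_mul_s]
        have := monomial_mem_monomialSpan [a] ⟨E.range [a], E.range_mem_accSets [a]⟩ []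
        simpa only [monomial, wordMul, star_p] using this
    | add x y _ _ h1 h2 =>
      obtain ⟨x, hx, rfl⟩ := h1
      obtain ⟨y, hy, rfl⟩ := h2
      exact ⟨x + y, add_mem hx hy, rfl⟩
    | zero => exact ⟨0, zero_mem _, rfl⟩
    | mul x y _ _ h1 h2 =>
      obtain ⟨x, hx, rfl⟩ := h1
      obtain ⟨y, hy, rfl⟩ := h2
      exact ⟨x * y, mul_mem_monomialSpan hx hy, rfl⟩
    | smul r x _ h1 =>
      obtain ⟨x, hx, rfl⟩ := h1
      exact ⟨r • x, Submodule.smul_mem _ r hx, rfl⟩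
    | star x _ h1 =>
      obtain ⟨x, hx, rfl⟩ := h1
      exact ⟨star x, star_mem_monomialSpan hx, rfl⟩
  intro x
  have hx : (show E.universalSubalgebra from x).1 ∈ closure
      ((fun y : E.universalSubalgebra => y.1) '' (E.monomialSpan : Set E.CStar)) :=
    closure_mono (fun y hy => key y hy) (show E.universalSubalgebra from x).2
  exact closure_subtype.2 hx

/-! ### The gauge action on monomials -/

theorem wordMul_smul (α : List 𝒜) (c : ℂ) (x : E.CStar) :
    wordMul α (c • x) = c • wordMul α x := by
  induction α with
  | nil => rfl
  | cons a α ih => simp only [wordMul, ih, mul_smul_comm]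

theorem gauge_wordMul (z : Circle) (α : List 𝒜) (x : E.CStar) :
    E.gauge z (wordMul α x) = (z : ℂ) ^ α.length • wordMul α (E.gauge z x) := by
  induction α with
  | nil => simp [wordMul]
  | cons a α ih =>
    rw [wordMul, map_mul, ih, gauge_s, smul_mul_smul_comm, List.length_cons, pow_succ', wordMul]

theorem gauge_monomial (z : Circle) (α : List 𝒜) (A : E.accSets) (β : List 𝒜) :
    E.gauge z (monomial α A β) =
      ((z : ℂ) ^ α.length * ((z : ℂ)⁻¹) ^ β.length) • monomial α A β := by
  rw [monomial, gauge_wordMul, map_star, gauge_wordMul, gauge_p, star_smul, wordMul_smul, smul_smul,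
    star_pow, ← Circle.coe_inv, Circle.coe_inv_eq_conj]
  rfl

theorem continuous_gauge (z : Circle) : Continuous (E.gauge z) :=
  AddMonoidHomClass.continuous_of_bound (E.gauge z) 1 fun x => by
    simpa using NonUnitalStarAlgHom.norm_apply_le (E.gauge z) x

theorem isClosed_gaugeFixedPoints : IsClosed (E.gaugeFixedPoints : Set E.CStar) := by
  have : (E.gaugeFixedPoints : Set E.CStar) = ⋂ z, {x | E.gauge z x = x} := by
    ext x
    simp only [Set.mem_iInter]
    rfl
  rw [this]
  exact isClosed_iInter fun z => isClosed_eq (continuous_gauge z) continuous_id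

/-- The linear span of the monomials `s_α p_A s_β^*` of degree zero, that is, with `|α| = |β|`
(the elements `p_A` are included). -/
def degreeZeroSpan (E : LabelledGraph V Ed 𝒜) : Submodule ℂ E.CStar :=
  Submodule.span ℂ {x | ∃ α A β, α.length = β.length ∧ x = monomial α A β}

theorem degreeZeroSpan_subset_gaugeFixedPoints :
    (E.degreeZeroSpan : Set E.CStar) ⊆ E.gaugeFixedPoints := by
  intro x hx
  induction hx using Submodule.span_induction with
  | mem x hx =>
    obtain ⟨α, A, β, h, rfl⟩ := hx
    intro z
    rw [gauge_monomial, h, ← mul_pow, mul_inv_cancel₀ z.coe_ne_zero, one_pow, one_smul]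
  | zero => exact zero_mem _
  | add x y _ _ hx hy => exact add_mem hx hy
  | smul c x _ hx => exact SMulMemClass.smul_mem c hx

/-- The mean of `γ_z` over the `N`-th roots of unity `z`. It is a finite substitute for the
conditional expectation `∫ γ_z dz` onto the fixed-point algebra. -/
def gaugeMean (N : ℕ) (x : E.CStar) : E.CStar :=
  (N : ℂ)⁻¹ • ∑ j ∈ Finset.range N, E.gauge (Circle.exp (2 * Real.pi / N) ^ j) x

theorem gaugeMean_add (N : ℕ) (x y : E.CStar) :
    gaugeMean N (x + y) = gaugeMean N x + gaugeMean N y := by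
  simp only [gaugeMean, map_add, Finset.sum_add_distrib, smul_add]

theorem gaugeMean_smul (N : ℕ) (c : ℂ) (x : E.CStar) :
    gaugeMean N (c • x) = c • gaugeMean N x := by
  simp only [gaugeMean, map_smul, ← Finset.smul_sum, smul_comm c]

theorem norm_gaugeMean_le (N : ℕ) (x : E.CStar) : ‖gaugeMean N x‖ ≤ ‖x‖ := by
  rcases Nat.eq_zero_or_pos N with rfl | hN
  · simp [gaugeMean]
  have hN' : (0 : ℝ) < N := by exact_mod_cast hN
  rw [gaugeMean, norm_smul, norm_inv, Complex.norm_natCast, inv_mul_le_iff₀ hN']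
  refine (norm_sum_le_of_le _ fun j _ => NonUnitalStarAlgHom.norm_apply_le _ x).trans ?_
  simp

theorem gaugeMean_eq_self {N : ℕ} (hN : N ≠ 0) {x : E.CStar} (hx : x ∈ E.gaugeFixedPoints) :
    gaugeMean N x = x := by
  have hx' : ∀ z, E.gauge z x = x := hx
  have hN' : (N : ℂ) ≠ 0 := by exact_mod_cast hN
  simp only [gaugeMean, hx', Finset.sum_const, Finset.card_range]
  rw [← Nat.cast_smul_eq_nsmul ℂ, smul_smul, inv_mul_cancel₀ hN', one_smul]

theorem gaugeMean_monomial_of_ne {N : ℕ} {α β : List 𝒜} (A : E.accSets) (hα : α.length < N)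
    (hβ : β.length < N) (h : α.length ≠ β.length) : gaugeMean N (monomial α A β) = 0 := by
  have hN : N ≠ 0 := by omega
  set ζ : Circle := Circle.exp (2 * Real.pi / N) with hζdef
  have hζ : IsPrimitiveRoot (ζ : ℂ) N := by
    convert Complex.isPrimitiveRoot_exp N hN using 1
    rw [hζdef, Circle.coe_exp]
    push_cast
    ring_nf
  have hζ0 : (ζ : ℂ) ≠ 0 := ζ.coe_ne_zero
  set ω : ℂ := (ζ : ℂ) ^ α.length * ((ζ : ℂ)⁻¹) ^ β.length with hω
  have hω1 : ω ≠ 1 := fun h1 => h <| hζ.pow_inj hα hβ <| by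
    rw [hω, inv_pow] at h1
    exact eq_of_div_eq_one (by rwa [div_eq_mul_inv])
  have hωN : ω ^ N = 1 := by
    rw [hω, mul_pow, ← pow_mul, ← pow_mul, mul_comm _ N, mul_comm _ N, pow_mul, pow_mul, inv_pow,
      hζ.pow_eq_one, inv_one, one_pow, one_pow, one_mul]
  have hsum : ∑ j ∈ Finset.range N, ω ^ j = 0 := by
    rw [geom_sum_eq hω1, hωN, sub_self, zero_div]
  have hj (j : ℕ) : E.gauge (ζ ^ j) (monomial α A β) = ω ^ j • monomial α A β := by
    rw [gauge_monomial, hω]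
    push_cast
    congr 1
    rw [mul_pow, ← inv_pow, pow_right_comm, pow_right_comm _ j]
  simp only [gaugeMean, ← hζdef, hj]
  rw [← Finset.sum_smul, hsum, zero_smul, smul_zero]

theorem exists_gaugeMean_mem {x : E.CStar} (hx : x ∈ E.monomialSpan) :
    ∃ N₀, ∀ N ≥ N₀, gaugeMean N x ∈ E.degreeZeroSpan := by
  induction hx using Submodule.span_induction with
  | mem x hx =>
    obtain ⟨α, A, β, rfl⟩ := hx
    refine ⟨max α.length β.length + 1, fun N hN => ?_⟩
    by_cases h : α.length = β.length
    · have hmem : monomial α A β ∈ E.degreeZeroSpan := Submodule.subset_span ⟨α, A, β, h, rfl⟩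
      rwa [gaugeMean_eq_self (by omega) (degreeZeroSpan_subset_gaugeFixedPoints hmem)]
    · rw [gaugeMean_monomial_of_ne A (by omega) (by omega) h]
      exact zero_mem _
  | zero => exact ⟨0, fun N _ => by simp [gaugeMean]⟩
  | add x y _ _ hx hy =>
    obtain ⟨M, hM⟩ := hx
    obtain ⟨N, hN⟩ := hy
    refine ⟨max M N, fun K hK => ?_⟩
    rw [gaugeMean_add]
    exact add_mem (hM K (le_of_max_le_left hK)) (hN K (le_of_max_le_right hK))
  | smul c x _ hx =>
    obtain ⟨M, hM⟩ := hx
    refine ⟨M, fun K hK => ?_⟩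
    rw [gaugeMean_smul]
    exact Submodule.smul_mem _ c (hM K hK)

/-- The fixed points are the closure of the monomials of degree zero: averaging over sufficiently
many roots of unity turns an approximation of a fixed point by a combination of monomials into
one by a combination of monomials of degree zero. -/
theorem gaugeFixedPoints_eq_closure :
    (E.gaugeFixedPoints : Set E.CStar) = closure (E.degreeZeroSpan : Set E.CStar) := by
  refine Set.Subset.antisymm (fun x hx => Metric.mem_closure_iff.2 fun ε hε => ?_)
    (closure_minimal degreeZeroSpan_subset_gaugeFixedPoints isClosed_gaugeFixedPoints)
  obtain ⟨y, hy, hxy⟩ := Metric.mem_closure_iff.1 (dense_monomialSpan x) ε hε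
  obtain ⟨N, hN⟩ := exists_gaugeMean_mem hy
  refine ⟨gaugeMean (N + 1) y, hN _ (Nat.le_succ N), lt_of_le_of_lt ?_ hxy⟩
  have h1 : x - gaugeMean (N + 1) y = gaugeMean (N + 1) (x - y) := by
    rw [sub_eq_add_neg x y, ← neg_one_smul ℂ y, gaugeMean_add, gaugeMean_smul,
      gaugeMean_eq_self N.succ_ne_zero hx, neg_one_smul, sub_eq_add_neg]
  rw [dist_eq_norm, dist_eq_norm, h1]
  exact norm_gaugeMean_le _ _

/-! ### Finite blocks of monomials of degree zero -/

/-- The linear span of the monomials `s_α p_A s_β^*` with words `α`, `β` in `W` and `A` in `𝒮`. -/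
def blockSpan (W : Set (List 𝒜)) (𝒮 : Set E.accSets) : Submodule ℂ E.CStar :=
  Submodule.span ℂ {x | ∃ α ∈ W, ∃ β ∈ W, ∃ A ∈ 𝒮, x = monomial α A β}

theorem blockSpan_mono {W W' : Set (List 𝒜)} {𝒮 𝒮' : Set E.accSets} (hW : W ⊆ W')
    (h𝒮 : 𝒮 ⊆ 𝒮') : blockSpan W 𝒮 ≤ blockSpan W' 𝒮' :=
  Submodule.span_mono fun _ ⟨α, hα, β, hβ, A, hA, h⟩ => ⟨α, hW hα, β, hW hβ, A, h𝒮 hA, h⟩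

theorem finiteDimensional_blockSpan {W : Set (List 𝒜)} {𝒮 : Set E.accSets} (hW : W.Finite)
    (h𝒮 : 𝒮.Finite) : FiniteDimensional ℂ (blockSpan W 𝒮) := by
  have h : {x : E.CStar | ∃ α ∈ W, ∃ β ∈ W, ∃ A ∈ 𝒮, x = monomial α A β} ⊆
      (fun t : List 𝒜 × List 𝒜 × E.accSets => monomial t.1 t.2.2 t.2.1) '' (W ×ˢ W ×ˢ 𝒮) := by
    rintro x ⟨α, hα, β, hβ, A, hA, rfl⟩
    exact ⟨(α, β, A), ⟨hα, hβ, hA⟩, rfl⟩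
  exact FiniteDimensional.span_of_finite ℂ (((hW.prod (hW.prod h𝒮)).image _).subset h)

/-- `x` is a linear combination of finitely many monomials whose words all have length `K`. -/
def IsBlockSum (K : ℕ) (x : E.CStar) : Prop :=
  ∃ (W : Set (List 𝒜)) (𝒮 : Set E.accSets), W.Finite ∧ 𝒮.Finite ∧ (∀ α ∈ W, α.length = K) ∧
    x ∈ blockSpan W 𝒮

/-- Every `p_A` in the middle of a monomial expands over the finitely many letters emitted by `A`,
so all words can be lengthened by one letter. -/
theorem IsBlockSum.succ (hsf : E.IsSetFinite) {K : ℕ} {x : E.CStar} (hx : IsBlockSum K x) :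
    IsBlockSum (K + 1) x := by
  obtain ⟨W, 𝒮, hW, h𝒮, hlen, hx⟩ := hx
  let L : Set 𝒜 := ⋃ A ∈ 𝒮, E.emitted A.1
  have hL : L.Finite := h𝒮.biUnion fun A _ => hsf A.1 A.2
  refine ⟨Set.image2 (fun α a => α ++ [a]) W L,
    Set.image2 (fun A a => ⟨E.relRange A.1 [a], E.relRange_mem_accSets A.2 [a]⟩) 𝒮 L,
    hW.image2 _ hL, h𝒮.image2 _ hL, ?_, ?_⟩
  · rintro _ ⟨α, hα, a, _, rfl⟩
    simp [hlen α hα]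
  · refine Submodule.span_le.2 ?_ hx
    rintro x ⟨α, hα, β, hβ, A, hA, rfl⟩
    rw [monomial_eq_sum hsf α A β]
    refine Submodule.sum_mem _ fun a ha => Submodule.subset_span ?_
    have haL : a ∈ L := Set.mem_biUnion hA ((Set.Finite.mem_toFinset _).1 ha)
    exact ⟨_, ⟨α, hα, a, haL, rfl⟩, _, ⟨β, hβ, a, haL, rfl⟩, _, ⟨A, hA, a, haL, rfl⟩, rfl⟩

theorem exists_isBlockSum (hsf : E.IsSetFinite) {x : E.CStar} (hx : x ∈ E.degreeZeroSpan) :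
    ∃ K₀, ∀ K ≥ K₀, IsBlockSum K x := by
  induction hx using Submodule.span_induction with
  | mem x hx =>
    obtain ⟨α, A, β, h, rfl⟩ := hx
    refine ⟨α.length, fun K hK => ?_⟩
    induction K, hK using Nat.le_induction with
    | base =>
      refine ⟨{α, β}, {A}, Set.toFinite _, Set.toFinite _, ?_,
        Submodule.subset_span ⟨α, by simp, β, by simp, A, rfl, rfl⟩⟩
      rintro γ (rfl | rfl)
      exacts [rfl, h.symm]
    | succ K _ ih => exact ih.succ hsf
  | zero => exact ⟨0, fun K _ => ⟨∅, ∅, Set.finite_empty, Set.finite_empty, by simp, zero_mem _⟩⟩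
  | add x y _ _ hx hy =>
    obtain ⟨M, hM⟩ := hx
    obtain ⟨N, hN⟩ := hy
    refine ⟨max M N, fun K hK => ?_⟩
    obtain ⟨W, 𝒮, hW, h𝒮, hlen, hx⟩ := hM K (le_of_max_le_left hK)
    obtain ⟨W', 𝒮', hW', h𝒮', hlen', hy⟩ := hN K (le_of_max_le_right hK)
    exact ⟨W ∪ W', 𝒮 ∪ 𝒮', hW.union hW', h𝒮.union h𝒮',
      fun α hα => hα.elim (hlen α) (hlen' α),
      add_mem (blockSpan_mono Set.subset_union_left Set.subset_union_left hx)
        (blockSpan_mono Set.subset_union_right Set.subset_union_right hy)⟩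
  | smul c x _ hx =>
    obtain ⟨M, hM⟩ := hx
    refine ⟨M, fun K hK => ?_⟩
    obtain ⟨W, 𝒮, hW, h𝒮, hlen, hx⟩ := hM K hK
    exact ⟨W, 𝒮, hW, h𝒮, hlen, Submodule.smul_mem _ c hx⟩

/-- A finite block of monomials with words of a common length `K ≥ 1` becomes a ⋆-subalgebra when
its sets are closed under intersections and contain the ranges of its words. -/
theorem exists_finiteDimensional_of_block {W : Set (List 𝒜)} {𝒮 : Set E.accSets} {K : ℕ}
    (hK : 1 ≤ K) (hW : W.Finite) (h𝒮 : 𝒮.Finite) (hlen : ∀ α ∈ W, α.length = K) :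
    ∃ S : NonUnitalStarSubalgebra ℂ E.CStar, FiniteDimensional ℂ S ∧
      (blockSpan W 𝒮 : Set E.CStar) ⊆ S := by
  have hne : ∀ α ∈ W, α ≠ [] := by
    rintro α hα rfl
    have := hlen _ hα
    simp at this
    omega
  let 𝒢 : Set (Set V) := infClosure (Subtype.val '' 𝒮 ∪ E.range '' W)
  have h𝒢 : 𝒢.Finite := ((h𝒮.image _).union (hW.image _)).infClosure
  have hinf : InfClosed 𝒢 := infClosed_infClosure
  let 𝒯 : Set E.accSets := {A | A.1 ∈ 𝒢}
  have h𝒯 : 𝒯.Finite := h𝒢.preimage Subtype.val_injective.injOn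
  have hr : ∀ α ∈ W, E.range α ∈ 𝒢 := fun α hα => subset_infClosure (Or.inr ⟨α, hα, rfl⟩)
  have hmul : ∀ x ∈ blockSpan W 𝒯, ∀ y ∈ blockSpan W 𝒯, x * y ∈ blockSpan W 𝒯 := by
    intro x hx y hy
    induction hx, hy using Submodule.span_induction₂ with
    | mem_mem x y hx hy =>
      obtain ⟨α, hα, β, hβ, A, hA, rfl⟩ := hx
      obtain ⟨μ, hμ, ν, hν, B, hB, rfl⟩ := hy
      by_cases h : β = μ
      · subst h
        rw [monomial_mul_monomial A B (hne α hα) (hne β hβ) (hne ν hν)]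
        exact Submodule.subset_span
          ⟨α, hα, ν, hν, _, hinf hA (hinf (hr β hβ) hB), rfl⟩
      · rw [monomial_mul_monomial_of_ne A B (hne α hα) (hne β hβ) (hne μ hμ) (hne ν hν)
          ((hlen β hβ).trans (hlen μ hμ).symm) h]
        exact zero_mem _
    | zero_left y hy => simp
    | zero_right x hx => simp
    | add_left x y z _ _ _ h1 h2 => simpa [add_mul] using add_mem h1 h2
    | add_right x y z _ _ _ h1 h2 => simpa [mul_add] using add_mem h1 h2
    | smul_left c x y _ _ h => simpa [smul_mul_assoc] using Submodule.smul_mem _ c h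
    | smul_right c x y _ _ h => simpa [mul_smul_comm] using Submodule.smul_mem _ c h
  have hstar : ∀ x ∈ blockSpan W 𝒯, star x ∈ blockSpan W 𝒯 := by
    intro x hx
    induction hx using Submodule.span_induction with
    | mem x hx =>
      obtain ⟨α, hα, β, hβ, A, hA, rfl⟩ := hx
      rw [star_monomial]
      exact Submodule.subset_span ⟨β, hβ, α, hα, A, hA, rfl⟩
    | zero => simp
    | add x y _ _ hx hy => simpa using add_mem hx hy
    | smul c x _ hx => simpa using Submodule.smul_mem _ _ hx
  let S : NonUnitalStarSubalgebra ℂ E.CStar :=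
    { carrier := blockSpan W 𝒯
      add_mem' := fun hx hy => add_mem hx hy
      zero_mem' := zero_mem _
      mul_mem' := fun hx hy => hmul _ hx _ hy
      smul_mem' := fun c x hx => Submodule.smul_mem _ c hx
      star_mem' := fun hx => hstar _ hx }
  refine ⟨S, finiteDimensional_blockSpan (E := E) hW h𝒯, ?_⟩
  exact blockSpan_mono subset_rfl fun A hA => subset_infClosure (Or.inl ⟨A, hA, rfl⟩)

/-- Finitely many combinations of monomials of degree zero lie in a finite-dimensional
⋆-subalgebra, since they can all be written with words of the same length. -/
theorem exists_finiteDimensional_of_finite (hsf : E.IsSetFinite) {T : Set E.CStar}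
    (hT : T.Finite) (hTD : T ⊆ E.degreeZeroSpan) :
    ∃ S : NonUnitalStarSubalgebra ℂ E.CStar, FiniteDimensional ℂ S ∧ T ⊆ S := by
  have key : ∃ K₀, ∀ K ≥ K₀, ∃ (W : Set (List 𝒜)) (𝒮 : Set E.accSets), W.Finite ∧ 𝒮.Finite ∧
      (∀ α ∈ W, α.length = K) ∧ T ⊆ blockSpan W 𝒮 := by
    induction T, hT using Set.Finite.induction_on with
    | empty => exact ⟨0, fun K _ => ⟨∅, ∅, by simp⟩⟩
    | @insert x T _ _ ih =>
      obtain ⟨M, hM⟩ := exists_isBlockSum hsf (hTD (Set.mem_insert x T))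
      obtain ⟨N, hN⟩ := ih ((Set.subset_insert x T).trans hTD)
      refine ⟨max M N, fun K hK => ?_⟩
      obtain ⟨W, 𝒮, hW, h𝒮, hlen, hx⟩ := hM K (le_of_max_le_left hK)
      obtain ⟨W', 𝒮', hW', h𝒮', hlen', hT⟩ := hN K (le_of_max_le_right hK)
      refine ⟨W ∪ W', 𝒮 ∪ 𝒮', hW.union hW', h𝒮.union h𝒮',
        fun α hα => hα.elim (hlen α) (hlen' α), Set.insert_subset ?_ (hT.trans ?_)⟩
      · exact blockSpan_mono Set.subset_union_left Set.subset_union_left hx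
      · exact blockSpan_mono Set.subset_union_right Set.subset_union_right
  obtain ⟨K, hK⟩ := key
  obtain ⟨W, 𝒮, hW, h𝒮, hlen, hT⟩ := hK (K + 1) (Nat.le_succ K)
  obtain ⟨S, hS, hWS⟩ := exists_finiteDimensional_of_block (Nat.le_add_left 1 K) hW h𝒮 hlen
  exact ⟨S, hS, hT.trans hWS⟩

/-! ### The core -/

theorem monomial_mem_coreLevel {k ℓ : ℕ} (hk : 1 ≤ k) {α β : List 𝒜} {A : E.accSets}
    (hα : α.length = k) (hβ : β.length = k) (hA : A.1 ∈ E.accSetsLevel ℓ) :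
    monomial α A β ∈ E.coreLevel k ℓ := by
  have hα0 : α ≠ [] := by rintro rfl; simp at hα; omega
  have hβ0 : β ≠ [] := by rintro rfl; simp at hβ; omega
  rw [monomial_eq hα0 hβ0]
  by_cases h : α ∈ E.labelledPaths ∧ β ∈ E.labelledPaths
  · exact Submodule.le_topologicalClosure _ (Submodule.subset_span
      ⟨α, ⟨h.1, hα⟩, β, ⟨h.2, hβ⟩, A, hA, rfl⟩)
  · have h0 : E.sWord α * E.universalRep.p A * star (E.sWord β) = 0 := by
      rcases not_and_or.1 h with h | h <;> simp [sWord_eq_zero h]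
    rw [h0]
    exact zero_mem _

theorem coreLevel_le (k ℓ : ℕ) :
    E.coreLevel k ℓ ≤ E.degreeZeroSpan.topologicalClosure := by
  refine Submodule.topologicalClosure_mono (Submodule.span_le.2 ?_)
  rintro x ⟨α, hα, β, hβ, A, -, rfl⟩
  obtain ⟨⟨_, _, hα⟩, hα'⟩ := hα
  obtain ⟨⟨_, _, hβ⟩, hβ'⟩ := hβ
  rw [← monomial_eq hα.ne_nil hβ.ne_nil]
  exact Submodule.subset_span ⟨α, A, β, hα'.trans hβ'.symm, rfl⟩

theorem exists_mem_coreLevel (hwlr : E.IsWeaklyLeftResolving) (hsf : E.IsSetFinite)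
    {x : E.CStar} (hx : x ∈ E.degreeZeroSpan) :
    ∃ k ℓ, 1 ≤ k ∧ k ≤ ℓ ∧ x ∈ E.coreLevel k ℓ := by
  obtain ⟨K, hK⟩ := exists_isBlockSum hsf hx
  obtain ⟨W, 𝒮, -, h𝒮, hlen, hx⟩ := hK (K + 1) (Nat.le_succ K)
  choose f hf using fun A : E.accSets => exists_mem_accSetsLevel hwlr A.2
  obtain ⟨m, hm⟩ := (h𝒮.image f).bddAbove
  refine ⟨K + 1, max (K + 1) m, Nat.le_add_left 1 K, le_max_left _ _, ?_⟩
  refine Submodule.span_le.2 ?_ hx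
  rintro x ⟨α, hα, β, hβ, A, hA, rfl⟩
  exact monomial_mem_coreLevel (Nat.le_add_left 1 K) (hlen α hα) (hlen β hβ)
    (accSetsLevel_mono ((hm ⟨A, hA, rfl⟩).trans (le_max_right _ _)) (hf A))

theorem coreSet_eq_closure (hwlr : E.IsWeaklyLeftResolving) (hsf : E.IsSetFinite) :
    E.coreSet = closure (E.degreeZeroSpan : Set E.CStar) := by
  refine Set.Subset.antisymm (closure_minimal ?_ isClosed_closure) (closure_mono ?_)
  · exact Set.iUnion_subset fun k => Set.iUnion_subset fun ℓ => Set.iUnion_subset fun _ =>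
      Set.iUnion_subset fun _ => coreLevel_le k ℓ
  · intro x hx
    obtain ⟨k, ℓ, hk, hl, h⟩ := exists_mem_coreLevel hwlr hsf hx
    simp only [Set.mem_iUnion]
    exact ⟨k, ℓ, hk, hl, h⟩

theorem isAFSubalgebra_gaugeFixedPoints [Countable 𝒜] (hsf : E.IsSetFinite) :
    IsAFSubalgebra E.gaugeFixedPoints := by
  refine ⟨isClosed_gaugeFixedPoints, ?_⟩
  let ι : E.gaugeFixedPoints →⋆ₙₐ[ℂ] E.CStar :=
    NonUnitalStarSubalgebraClass.subtype E.gaugeFixedPoints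
  have hι : Function.Injective ι := Subtype.val_injective
  let G : Set E.CStar := {x | ∃ α A β, α.length = β.length ∧ x = monomial α A β}
  have hGD : G ⊆ E.degreeZeroSpan := Submodule.subset_span
  have : Countable E.accSets := countable_accSets.to_subtype
  have hG : G.Countable := by
    refine (Set.countable_range
      fun t : List 𝒜 × E.accSets × List 𝒜 => monomial t.1 t.2.1 t.2.2).mono ?_
    rintro x ⟨α, A, β, -, rfl⟩
    exact ⟨(α, A, β), rfl⟩
  -- Inserting `0` guarantees a nonempty set to enumerate, even when there are no monomials.
  obtain ⟨g, hg⟩ := (hG.insert 0).exists_eq_range (Set.insert_nonempty 0 G)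
  have hgD (n : ℕ) : g n ∈ E.degreeZeroSpan := by
    have : g n ∈ insert 0 G := hg ▸ Set.mem_range_self n
    rcases this with h | h
    · rw [h]
      exact zero_mem _
    · exact hGD h
  let S (n : ℕ) : NonUnitalStarSubalgebra ℂ E.CStar :=
    NonUnitalStarAlgebra.adjoin ℂ (g '' Set.Iic n)
  have hS : Monotone S := fun m n h =>
    NonUnitalStarAlgebra.adjoin_mono (Set.image_mono (Set.Iic_subset_Iic.2 h))
  refine ⟨fun n => (S n).comap ι, fun m n h x hx => hS h hx, fun n => ?_, ?_⟩
  · obtain ⟨T, hT, hgT⟩ := exists_finiteDimensional_of_finite hsf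
      ((Set.finite_Iic n).image g) (by rintro _ ⟨k, -, rfl⟩; exact hgD k)
    have hST : S n ≤ T := NonUnitalStarAlgebra.adjoin_le hgT
    let j : (S n).comap ι →ₗ[ℂ] T :=
      { toFun := fun x => ⟨ι x.1, hST x.2⟩
        map_add' := fun _ _ => rfl
        map_smul' := fun _ _ => rfl }
    exact FiniteDimensional.of_injective j fun x y h =>
      Subtype.ext (hι (congrArg (fun t : T => t.1) h))
  · have hD : ∀ x ∈ E.degreeZeroSpan, ∃ n, x ∈ S n := by
      intro x hx
      induction hx using Submodule.span_induction with
      | mem x hx =>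
        obtain ⟨n, rfl⟩ : x ∈ Set.range g := hg ▸ Set.mem_insert_of_mem 0 hx
        exact ⟨n, NonUnitalStarAlgebra.subset_adjoin ℂ _ ⟨n, Set.mem_Iic.2 le_rfl, rfl⟩⟩
      | zero => exact ⟨0, zero_mem _⟩
      | add x y _ _ hx hy =>
        obtain ⟨m, hx⟩ := hx
        obtain ⟨n, hy⟩ := hy
        exact ⟨max m n, add_mem (hS (le_max_left m n) hx) (hS (le_max_right m n) hy)⟩
      | smul c x _ hx =>
        obtain ⟨m, hx⟩ := hx
        exact ⟨m, SMulMemClass.smul_mem c hx⟩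
    intro x
    -- Density in the subtype is tested in `C*(E, 𝓛, 𝓔^{0,-})`.
    refine closure_subtype.2 (closure_mono (fun y hy => ?_)
      (gaugeFixedPoints_eq_closure.subset x.2))
    obtain ⟨n, hn⟩ := hD y hy
    exact ⟨⟨y, degreeZeroSpan_subset_gaugeFixedPoints hy⟩, Set.mem_iUnion.2 ⟨n, hn⟩, rfl⟩

end LabelledGraph

end

theorem theorem4p4 {V Ed 𝒜 : Type*} [Countable 𝒜]
    (E : LabelledGraph V Ed 𝒜) (hess : E.IsEssential) (hwlr : E.IsWeaklyLeftResolving)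
    (hsf : E.IsSetFinite) (hrsf : E.IsReceiverSetFinite) :
    ∃ 𝓕 : NonUnitalStarSubalgebra ℂ E.CStar,
      (𝓕 : Set E.CStar) = E.coreSet ∧
      IsAFSubalgebra 𝓕 ∧
      𝓕 = E.gaugeFixedPoints ∧
      Nonempty (𝓕 ≃⋆ₐ[ℂ] E.gaugeFixedPoints) :=
  ⟨E.gaugeFixedPoints,
    LabelledGraph.gaugeFixedPoints_eq_closure.trans
      (LabelledGraph.coreSet_eq_closure hwlr hsf).symm,
    LabelledGraph.isAFSubalgebra_gaugeFixedPoints hsf, rfl, ⟨StarAlgEquiv.refl ℂ _⟩⟩
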